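/- **Lemma 6.3 ($\mathcal{D}\subset\mathcal{E}$).** Let $m\ge 3$ and let $M=S^{2m+3}\subset\mathbb{C}^{m}\times\mathbb{C}^{2}$ be the unit sphere with its round metric $g_0$. Let $G=S^1$ act on $M$ by $\sigma(u,v)=(\sigma u,v)$ and let $T=S^1\times S^1$ act on $M$ by $(\sigma_1,\sigma_2)(u,v_1,v_2)=(u,\sigma_1v_1,\sigma_2v_2)$. Let $M_{\mathrm{princ}}\subset M$ be the open set of points with trivial $G$-stabilizer, and equip the manifold $G\backslash M_{\mathrm{princ}}$ with the induced $T$-action and with the Riemannian metric $h_0$ for which the projection $(M_{\mathrm{princ}},g_0)\to G\backslash M_{\mathrm{princ}}$ is a Riemannian submersion. Let $G\backslash\widehat M\subset G\backslash M_{\mathrm{princ}}$ be the open set of points with trivial $T$-stabilizer, and let $h_0^T$ be the Riemannian metric on $T\backslash(G\backslash\widehat M)$ for which $(G\backslash\widehat M,h_0)\to T\backslash(G\backslash\widehat M)$ is a Riemannian submersion. Let $\mathfrak{t}=T_{(1,1)}T\subset\mathbb{C}^2$, with basis $Z_1=(i,0)$, $Z_2=(0,i)$. A diffeomorphism $F$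 of $G\backslash M_{\mathrm{princ}}$ is called $T$-preserving if $c^F(z):=F\circ z\circ F^{-1}$ belongs to $T$ (regarded as a group of diffeomorphisms of $G\backslash M_{\mathrm{princ}}$) for every $z\in T$; then $\Psi_F:=c^F_*\colon\mathfrak{t}\to\mathfrak{t}$ denotes the differential of $c^F\colon T\to T$ at the identity. Let $\mathrm{Aut}^T_{h_0}(G\backslash M_{\mathrm{princ}})$ be the set of all $T$-preserving diffeomorphisms $F$ of $G\backslash M_{\mathrm{princ}}$ which preserve the $h_0$-norm of all vectors tangent to $T$-orbits in $G\backslash\widehat M$ and which induce an isometry of the Riemannian manifold $(T\backslash(G\backslash\widehat M),h_0^T)$. Put $$\mathcal{D}:=\{\Psi_F : F\in \mathrm{Aut}^T_{h_0}(G\backslash M_{\mathrm{princ}})\},\qquad \mathcal{E}:=\{\phi\in\mathrm{Aut}(\mathfrak{t}) : \phi(Z_k)\in\{\pm Z_1,\pm Z_2\}\text{ for }k=1,2\}.$$ Then $\mathcal{D}\subset\mathcal{E}$. -/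

import Mathlib

open scoped Manifold ContDiff
open Set

noncomputable section

namespace SphereQuotient

/-! ### A way to build charts on a quotient space

A chart of a quotient `X / s` is given by an invariant map `φ` on an invariant open set `U` together
with a continuous local section `σ` of the projection, such that `φ` and `σ` are inverse to each
other up to the equivalence relation. -/

/-- The chart `[x] ↦ φ x` of `X / s` with domain `{[x] ; x ∈ U}` and with inverse `h ↦ [σ h]`. -/
def quotChart {X H : Type*} [TopologicalSpace X] [TopologicalSpace H] (s : Setoid X)
    (φ : X → H) (U : Set X) (σ : H → X)
    (hφ : ∀ x y, s x y → φ x = φ y) (hU : IsOpen U) (hUs : ∀ x y, s x y → (x ∈ U ↔ y ∈ U))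
    (hφc : ContinuousOn φ U) (hσc : Continuous σ) (hσU : ∀ h, σ h ∈ U)
    (hφσ : ∀ h, φ (σ h) = h) (hσφ : ∀ x ∈ U, s (σ (φ x)) x) :
    OpenPartialHomeomorph (Quotient s) H where
  toFun := Quotient.lift φ hφ
  invFun := fun h => Quotient.mk s (σ h)
  source := {q | Quotient.lift (fun x => x ∈ U) (fun x y h => propext (hUs x y h)) q}
  target := univ
  map_source' := fun _ _ => mem_univ _
  map_target' := fun h _ => hσU h
  left_inv' := by
    intro q hq
    induction q using Quotient.inductionOn with
    | h x => exact Quotient.sound (hσφ x hq)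
  right_inv' := fun h _ => hφσ h
  open_source := by
    have : IsOpen (Quotient.mk s ⁻¹'
        {q | Quotient.lift (fun x => x ∈ U) (fun x y h => propext (hUs x y h)) q}) := hU
    exact isQuotientMap_quot_mk.isOpen_preimage.mp this
  open_target := isOpen_univ
  continuousOn_toFun := by
    have ho : IsOpen {q : Quotient s |
        Quotient.lift (fun x => x ∈ U) (fun x y h => propext (hUs x y h)) q} :=
      isQuotientMap_quot_mk.isOpen_preimage.mp hU
    exact (isQuotientMap_quot_mk.continuousOn_isOpen_iff ho).mpr hφc
  continuousOn_invFun := (continuous_quot_mk.comp hσc).continuousOn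

/-! ### The sphere and the two actions -/

/-- `ℂ^{m+2} = ℂ^m × ℂ^2`; the point `(u, v)` has the coordinates `u j = x (Sum.inl j)` and
`v k = x (Sum.inr k)`. -/
abbrev Amb (m : ℕ) : Type := EuclideanSpace ℂ (Fin m ⊕ Fin 2)

instance factFinrankAmb (m : ℕ) : Fact (Module.finrank ℝ (Amb m) = (2 * m + 3) + 1) :=
  ⟨by rw [finrank_real_of_complex]; simp; ring⟩

/-- The sphere `S^{2m+3} ⊂ ℂ^{m+2}`, with the smooth structure of Mathlib. -/
abbrev Sph (m : ℕ) : Type := Metric.sphere (0 : Amb m) 1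

/-- The torus `T = S^1 × S^1`. -/
abbrev Tor : Type := Circle × Circle

/-- The map `(u, v) ↦ (σ u, v)`. -/
def gAmb {m : ℕ} (σ : Circle) (x : Amb m) : Amb m :=
  WithLp.toLp 2 (Sum.elim (fun j => (σ : ℂ) * x (Sum.inl j)) (fun k => x (Sum.inr k)))

/-- The map `(u, v₁, v₂) ↦ (u, σ₁ v₁, σ₂ v₂)`. -/
def tAmb {m : ℕ} (z : Tor) (x : Amb m) : Amb m :=
  WithLp.toLp 2 (Sum.elim (fun j => x (Sum.inl j))
    ![(z.1 : ℂ) * x (Sum.inr 0), (z.2 : ℂ) * x (Sum.inr 1)])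

@[simp] theorem gAmb_inl {m : ℕ} (σ : Circle) (x : Amb m) (j : Fin m) :
    gAmb σ x (Sum.inl j) = σ * x (Sum.inl j) := rfl
@[simp] theorem gAmb_inr {m : ℕ} (σ : Circle) (x : Amb m) (k : Fin 2) :
    gAmb σ x (Sum.inr k) = x (Sum.inr k) := rfl
@[simp] theorem tAmb_inl {m : ℕ} (z : Tor) (x : Amb m) (j : Fin m) :
    tAmb z x (Sum.inl j) = x (Sum.inl j) := rfl
@[simp] theorem tAmb_inr_zero {m : ℕ} (z : Tor) (x : Amb m) :
    tAmb z x (Sum.inr 0) = z.1 * x (Sum.inr 0) := rfl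
@[simp] theorem tAmb_inr_one {m : ℕ} (z : Tor) (x : Amb m) :
    tAmb z x (Sum.inr 1) = z.2 * x (Sum.inr 1) := rfl

theorem norm_gAmb {m : ℕ} (σ : Circle) (x : Amb m) : ‖gAmb σ x‖ = ‖x‖ := by
  simp [EuclideanSpace.norm_eq, Circle.norm_coe]

theorem norm_tAmb {m : ℕ} (z : Tor) (x : Amb m) : ‖tAmb z x‖ = ‖x‖ := by
  simp [EuclideanSpace.norm_eq, Circle.norm_coe]

theorem amb_ext {m : ℕ} {x y : Amb m} (h : ∀ j, x (Sum.inl j) = y (Sum.inl j))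
    (h0 : x (Sum.inr 0) = y (Sum.inr 0)) (h1 : x (Sum.inr 1) = y (Sum.inr 1)) : x = y := by
  ext i
  rcases i with j | k
  · exact h j
  · fin_cases k
    · exact h0
    · exact h1

/-- The action of `G = S^1` on the sphere. -/
def gAct {m : ℕ} (σ : Circle) (x : Sph m) : Sph m :=
  ⟨gAmb σ x, by simp [norm_gAmb]⟩

/-- The action of `T` on the sphere. -/
def tAct {m : ℕ} (z : Tor) (x : Sph m) : Sph m :=
  ⟨tAmb z x, by simp [norm_tAmb]⟩

/-! ### The manifold `G \ M_princ` -/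

theorem gAct_free_iff {m : ℕ} (x : Sph m) :
    (∀ σ, gAct σ x = x → σ = 1) ↔ ∃ j, x.1 (Sum.inl j) ≠ 0 := by
  constructor
  · intro h
    by_contra! hx
    have h1 : (Circle.exp Real.pi) = 1 := h _ (Subtype.ext (amb_ext (by simp [gAct, hx])
      (by simp [gAct]) (by simp [gAct])))
    have := congrArg (fun z : Circle => (z : ℂ)) h1
    norm_num [Circle.coe_exp, Complex.exp_pi_mul_I] at this
  · rintro ⟨j, hj⟩ σ h
    have : (σ : ℂ) * x.1 (Sum.inl j) = x.1 (Sum.inl j) :=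
      congrArg (fun y : Sph m => y.1 (Sum.inl j)) h
    exact Circle.ext (by simpa [hj] using this)

/-- `M_princ ⊂ M`, the union of the principal `G`-orbits; as `G` is abelian, these are the points
with trivial `G`-stabilizer. -/
def Mprinc (m : ℕ) : TopologicalSpace.Opens (Sph m) where
  carrier := {x | ∀ σ, gAct σ x = x → σ = 1}
  is_open' := by
    simp only [gAct_free_iff, ofPred_exists]
    exact isOpen_iUnion fun j => isOpen_ne_fun (by fun_prop) continuous_const

/-- The action of `G` on `M_princ`. -/
def gP {m : ℕ} (σ : Circle) (x : Mprinc m) : Mprinc m :=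
  ⟨gAct σ x, (gAct_free_iff _).2 (by
    obtain ⟨j, hj⟩ := (gAct_free_iff _).1 x.2
    exact ⟨j, by simpa [gAct] using hj⟩)⟩

/-- The action of `T` on `M_princ`. -/
def tP {m : ℕ} (z : Tor) (x : Mprinc m) : Mprinc m :=
  ⟨tAct z x, (gAct_free_iff _).2 (by
    obtain ⟨j, hj⟩ := (gAct_free_iff _).1 x.2
    exact ⟨j, by simpa [tAct] using hj⟩)⟩

/-- Lying on the same `G`-orbit. -/
def gSetoid (m : ℕ) : Setoid (Mprinc m) where
  r x y := ∃ σ, gP σ y = x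
  iseqv := by
    refine ⟨fun x => ⟨1, ?_⟩, ?_, ?_⟩
    · exact Subtype.ext (Subtype.ext (amb_ext (by simp [gP, gAct]) rfl rfl))
    · rintro x y ⟨σ, rfl⟩
      exact ⟨σ⁻¹, Subtype.ext (Subtype.ext (amb_ext (by simp [gP, gAct]) rfl rfl))⟩
    · rintro x y z ⟨σ, rfl⟩ ⟨τ, rfl⟩
      exact ⟨σ * τ, Subtype.ext (Subtype.ext (amb_ext (by simp [gP, gAct, mul_assoc]) rfl rfl))⟩

/-- The orbit space `G \ M_princ`, with the quotient topology. -/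
def QG (m : ℕ) : Type := Quotient (gSetoid m)

instance (m : ℕ) : TopologicalSpace (QG m) := inferInstanceAs (TopologicalSpace (Quotient _))

/-- The projection `ξ : M_princ → G \ M_princ`. -/
def xi {m : ℕ} (x : Mprinc m) : QG m := Quotient.mk (gSetoid m) x

/-- A numbering of the indices other than `i`. -/
def idx {m : ℕ} (i : Fin m) : Fin (m - 1) ≃ {j : Fin m // j ≠ i} :=
  Fintype.equivOfCardEq (by simp)

/-- The model space of `G \ M_princ`. -/
abbrev ModelG (m : ℕ) : Type := (Fin (m - 1) → ℂ) × (Fin 2 → ℂ)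

/-- `(u, v) ↦ ((u_j / u_i)_{j ≠ i}, v / |u_i|)`. -/
def phiG {m : ℕ} (i : Fin m) (x : Amb m) : ModelG m :=
  (fun k => x (Sum.inl (idx i k)) / x (Sum.inl i),
    fun k => x (Sum.inr k) / (‖x (Sum.inl i)‖ : ℂ))

/-- The vector `(u, v)` with `u_i = 1`, with the other `u_j` given by `h.1` and with `v = h.2`. -/
def preG {m : ℕ} (i : Fin m) (h : ModelG m) : Amb m :=
  WithLp.toLp 2 (Sum.elim
    (fun j => if hj : j = i then 1 else h.1 ((idx i).symm ⟨j, hj⟩)) h.2)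

theorem preG_inl_self {m : ℕ} (i : Fin m) (h : ModelG m) : preG i h (Sum.inl i) = 1 := by
  simp [preG]

theorem preG_inl_idx {m : ℕ} (i : Fin m) (h : ModelG m) (k : Fin (m - 1)) :
    preG i h (Sum.inl (idx i k)) = h.1 k := by
  simp [preG, (idx i k).2]

theorem preG_inr {m : ℕ} (i : Fin m) (h : ModelG m) (k : Fin 2) :
    preG i h (Sum.inr k) = h.2 k := rfl

theorem preG_ne_zero {m : ℕ} (i : Fin m) (h : ModelG m) : preG i h ≠ 0 := fun h0 => by
  have := preG_inl_self i h
  simp [h0] at this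

theorem contDiff_preG {m : ℕ} (i : Fin m) (l : Fin m ⊕ Fin 2) :
    ContDiff ℝ ∞ (fun h : ModelG m => preG i h l) := by
  rcases l with j | k
  · by_cases hj : j = i
    · simp only [preG, Sum.elim_inl, hj, dite_true]
      exact contDiff_const
    · simp only [preG, Sum.elim_inl, hj, dite_false]
      fun_prop
  · simp only [preG, Sum.elim_inr]
    fun_prop

theorem continuous_preG {m : ℕ} (i : Fin m) : Continuous (preG i) :=
  (PiLp.continuous_toLp 2 _).comp (continuous_pi fun l => (contDiff_preG i l).continuous)

/-- `preG` rescaled to a point of the sphere. -/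
def secG {m : ℕ} (i : Fin m) (h : ModelG m) : Mprinc m :=
  ⟨⟨(‖preG i h‖⁻¹ : ℝ) • preG i h, by
    simp [norm_smul, preG_ne_zero i h]⟩, (gAct_free_iff _).2 ⟨i, by
    simp [preG_inl_self, preG_ne_zero i h]⟩⟩

theorem continuous_secG {m : ℕ} (i : Fin m) : Continuous (secG i) :=
  ((((continuous_preG i).norm.inv₀ (fun h => norm_ne_zero_iff.2 (preG_ne_zero i h))).smul
    (continuous_preG i)).subtype_mk _).subtype_mk _

theorem phiG_smul {m : ℕ} (i : Fin m) {c : ℝ} (hc : 0 < c) (x : Amb m) :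
    phiG i (c • x) = phiG i x := by
  have hc' : (c : ℂ) ≠ 0 := by exact_mod_cast hc.ne'
  have hn : ‖(c : ℂ)‖ = c := by simp [abs_of_pos hc]
  ext k
  · simp [phiG, mul_div_mul_left _ _ hc']
  · simp [phiG, abs_of_pos hc, mul_div_mul_left _ _ hc']

theorem phiG_preG {m : ℕ} (i : Fin m) (h : ModelG m) : phiG i (preG i h) = h := by
  ext k
  · simp [phiG, preG_inl_self, preG_inl_idx]
  · simp [phiG, preG_inl_self, preG_inr]

theorem norm_preG_pos {m : ℕ} (i : Fin m) (h : ModelG m) : 0 < ‖preG i h‖⁻¹ :=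
  inv_pos.2 (norm_pos_iff.2 (preG_ne_zero i h))

theorem phiG_secG {m : ℕ} (i : Fin m) (h : ModelG m) : phiG i (secG i h).1.1 = h := by
  exact (phiG_smul i (norm_preG_pos i h) _).trans (phiG_preG i h)

theorem phiG_gAmb {m : ℕ} (i : Fin m) (σ : Circle) (x : Amb m) :
    phiG i (gAmb σ x) = phiG i x := by
  ext k
  · simp [phiG, mul_div_mul_left]
  · simp [phiG, Circle.norm_coe]

/-- The rescaled vector is `conj (u_i) / |u_i|` acting on the original one. -/
theorem preG_phiG {m : ℕ} (i : Fin m) (x : Amb m) (hx : x (Sum.inl i) ≠ 0) :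
    ∃ σ : Circle, (‖x (Sum.inl i)‖ : ℝ) • preG i (phiG i x) = gAmb σ x := by
  have hn : (‖x (Sum.inl i)‖ : ℂ) ≠ 0 := by simpa using hx
  obtain ⟨σ, hs⟩ : ∃ σ : Circle, (σ : ℂ) = (‖x (Sum.inl i)‖ : ℂ) / x (Sum.inl i) :=
    ⟨⟨_, by simp [Submonoid.unitSphere, hx]⟩, rfl⟩
  refine ⟨σ, amb_ext (fun j => ?_) ?_ ?_⟩
  · by_cases hj : j = i
    · subst hj
      simp [preG_inl_self, hs, hx]
    · obtain ⟨k, hk⟩ := (idx i).surjective ⟨j, hj⟩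
      have hk' : ((idx i k : {j // j ≠ i}) : Fin m) = j := by rw [hk]
      rw [← hk']
      simp [preG_inl_idx, phiG, hs]
      field_simp
  · simp [preG_inr, phiG]
    field_simp
  · simp [preG_inr, phiG]
    field_simp

theorem secG_phiG {m : ℕ} (i : Fin m) (x : Mprinc m) (hx : x.1.1 (Sum.inl i) ≠ 0) :
    gSetoid m (secG i (phiG i x.1.1)) x := by
  obtain ⟨σ, hσ⟩ := preG_phiG i x.1.1 hx
  refine ⟨σ, Subtype.ext (Subtype.ext ?_)⟩
  have h1 : ‖x.1.1 (Sum.inl i)‖ * ‖preG i (phiG i x.1.1)‖ = 1 := by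
    have := congrArg norm hσ
    rw [norm_smul, norm_gAmb] at this
    simpa using this
  change gAmb σ x.1.1 = ‖preG i (phiG i x.1.1)‖⁻¹ • preG i (phiG i x.1.1)
  rw [← hσ, eq_inv_of_mul_eq_one_left h1]

/-- The chart `[(u, v)] ↦ ((u_j / u_i)_{j ≠ i}, v / |u_i|)` of `G \ M_princ`, defined where
`u_i ≠ 0`; it takes all values in the model space. -/
def chartG {m : ℕ} (i : Fin m) : OpenPartialHomeomorph (QG m) (ModelG m) :=
  quotChart (gSetoid m) (fun x => phiG i x.1.1) {x | x.1.1 (Sum.inl i) ≠ 0} (secG i)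
    (by rintro x y ⟨σ, rfl⟩; exact phiG_gAmb i σ y.1.1)
    (isOpen_ne_fun (by fun_prop) continuous_const)
    (by rintro x y ⟨σ, rfl⟩; simp [gP, gAct])
    (by
      unfold phiG
      refine ContinuousOn.prodMk (continuousOn_pi.2 fun k => ?_) (continuousOn_pi.2 fun k => ?_)
      · exact ContinuousOn.div (by fun_prop) (by fun_prop) (fun x hx => hx)
      · exact ContinuousOn.div (by fun_prop) (by fun_prop) (fun x hx => by simpa using hx))
    (continuous_secG i)
    (fun h => by simp [secG, preG_inl_self, preG_ne_zero i h])
    (phiG_secG i) (secG_phiG i)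

theorem exists_chartG (m : ℕ) (q : QG m) : ∃ i : Fin m, q ∈ (chartG i).source := by
  induction q using Quotient.inductionOn with
  | h x => exact (gAct_free_iff _).1 x.2

instance chartedSpaceQG (m : ℕ) : ChartedSpace (ModelG m) (QG m) where
  atlas := range chartG
  chartAt q := chartG (exists_chartG m q).choose
  mem_chart_source q := (exists_chartG m q).choose_spec
  chart_mem_atlas _ := mem_range_self _

theorem contDiffOn_phiG_preG {m : ℕ} (i k : Fin m) :
    ContDiffOn ℝ ∞ (fun h : ModelG m => phiG k (preG i h))
      {h | preG i h (Sum.inl k) ≠ 0} := by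
  unfold phiG
  simp only [div_eq_mul_inv]
  refine ContDiffOn.prodMk (contDiffOn_pi.2 fun l => ?_) (contDiffOn_pi.2 fun l => ?_)
  · exact (contDiff_preG i _).contDiffOn.mul
      ((contDiff_preG i _).contDiffOn.inv (fun x hx => hx))
  · refine (contDiff_preG i _).contDiffOn.mul
      (ContDiffOn.inv ?_ (fun x hx => by simpa using hx))
    exact Complex.ofRealCLM.contDiff.comp_contDiffOn
      ((contDiff_preG i _).contDiffOn.norm ℝ (fun x hx => hx))

theorem chartG_symm_mem {m : ℕ} (i k : Fin m) (h : ModelG m)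
    (hh : (chartG i).symm h ∈ (chartG k).source) : preG i h (Sum.inl k) ≠ 0 := by
  change ‖preG i h‖⁻¹ • preG i h (Sum.inl k) ≠ 0 at hh
  exact right_ne_zero_of_smul hh

theorem chartG_symm_apply {m : ℕ} (i k : Fin m) (h : ModelG m) :
    chartG k ((chartG i).symm h) = phiG k (preG i h) :=
  phiG_smul k (norm_preG_pos i h) _

instance isManifoldQG (m : ℕ) : IsManifold 𝓘(ℝ, ModelG m) ∞ (QG m) := by
  apply isManifold_of_contDiffOn
  rintro _ _ ⟨i, rfl⟩ ⟨k, rfl⟩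
  refine ((contDiffOn_phiG_preG i k).mono ?_).congr ?_
  · rintro h ⟨⟨-, hh⟩, -⟩
    exact chartG_symm_mem i k h hh
  · intro h _
    exact chartG_symm_apply i k h

/-! ### The `T`-action on `G \ M_princ` and the manifold `T \ (G \ M̂)` -/

theorem tP_gP {m : ℕ} (z : Tor) (σ : Circle) (x : Mprinc m) : tP z (gP σ x) = gP σ (tP z x) :=
  Subtype.ext (Subtype.ext (amb_ext (fun _ => rfl) rfl rfl))

/-- The action of `T` on `G \ M_princ`. -/
def tQ {m : ℕ} (z : Tor) : QG m → QG m :=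
  Quotient.map (tP z) (by rintro _ y ⟨σ, rfl⟩; exact ⟨σ, (tP_gP z σ y).symm⟩)

theorem tQ_xi {m : ℕ} (z : Tor) (x : Mprinc m) : tQ z (xi x) = xi (tP z x) := rfl

theorem tQ_one {m : ℕ} (q : QG m) : tQ 1 q = q := by
  induction q using Quotient.inductionOn with
  | h x =>
    exact congrArg xi (Subtype.ext (Subtype.ext (amb_ext (fun _ => rfl) (by simp [tP, tAct])
      (by simp [tP, tAct]))))

theorem tQ_mul {m : ℕ} (z w : Tor) (q : QG m) : tQ (z * w) q = tQ z (tQ w q) := by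
  induction q using Quotient.inductionOn with
  | h x =>
    exact congrArg xi (Subtype.ext (Subtype.ext (amb_ext (fun _ => rfl)
      (by simp [tP, tAct, mul_assoc]) (by simp [tP, tAct, mul_assoc]))))

/-- `T` acts freely at `[(u, v)]` if and only if `v₁ ≠ 0` and `v₂ ≠ 0`. -/
theorem tQ_free_iff {m : ℕ} (x : Mprinc m) :
    (∀ z, tQ z (xi x) = xi x → z = 1) ↔ x.1.1 (Sum.inr 0) ≠ 0 ∧ x.1.1 (Sum.inr 1) ≠ 0 := by
  have hpi : (Circle.exp Real.pi) ≠ 1 := fun h1 => by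
    have := congrArg (fun z : Circle => (z : ℂ)) h1
    norm_num [Circle.coe_exp, Complex.exp_pi_mul_I] at this
  constructor
  · intro h
    constructor
    · intro h0
      have := h (Circle.exp Real.pi, 1) (congrArg xi (Subtype.ext (Subtype.ext
        (amb_ext (fun _ => rfl) (by simp [tP, tAct, h0]) (by simp [tP, tAct])))))
      exact hpi (congrArg Prod.fst this)
    · intro h0
      have := h (1, Circle.exp Real.pi) (congrArg xi (Subtype.ext (Subtype.ext
        (amb_ext (fun _ => rfl) (by simp [tP, tAct]) (by simp [tP, tAct, h0])))))
      exact hpi (congrArg Prod.snd this)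
  · rintro ⟨h0, h1⟩ z hz
    obtain ⟨σ, hσ⟩ := Quotient.exact hz
    have e0 := congrArg (fun y : Mprinc m => y.1.1 (Sum.inr 0)) hσ
    have e1 := congrArg (fun y : Mprinc m => y.1.1 (Sum.inr 1)) hσ
    simp only [gP, gAct, tP, tAct, gAmb_inr, tAmb_inr_zero, tAmb_inr_one] at e0 e1
    refine Prod.ext (Circle.ext ?_) (Circle.ext ?_)
    · exact (mul_right_cancel₀ h0 ((one_mul _).trans e0)).symm
    · exact (mul_right_cancel₀ h1 ((one_mul _).trans e1)).symm

/-- `G \ M̂`, the points of `G \ M_princ` with trivial `T`-stabilizer. -/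
def Qhat (m : ℕ) : TopologicalSpace.Opens (QG m) where
  carrier := {q | ∀ z, tQ z q = q → z = 1}
  is_open' := by
    refine isQuotientMap_quot_mk.isOpen_preimage.mp ?_
    have : IsOpen ({x : Mprinc m | x.1.1 (Sum.inr 0) ≠ 0} ∩ {x | x.1.1 (Sum.inr 1) ≠ 0}) :=
      (isOpen_ne_fun (by fun_prop) continuous_const).inter
        (isOpen_ne_fun (by fun_prop) continuous_const)
    convert this using 1
    exact Set.ext fun x => tQ_free_iff x

/-- The action of `T` on `G \ M̂`. -/
def tH {m : ℕ} (z : Tor) (q : Qhat m) : Qhat m :=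
  ⟨tQ z q, fun w hw => q.2 w (by
    rw [← tQ_mul, mul_comm, tQ_mul] at hw
    simpa [← tQ_mul, tQ_one] using congrArg (tQ z⁻¹) hw)⟩

/-- Lying on the same `T`-orbit. -/
def tSetoid (m : ℕ) : Setoid (Qhat m) where
  r p q := ∃ z, tH z q = p
  iseqv := by
    refine ⟨fun x => ⟨1, Subtype.ext (tQ_one _)⟩, ?_, ?_⟩
    · rintro x y ⟨z, rfl⟩
      exact ⟨z⁻¹, Subtype.ext (by simp [tH, ← tQ_mul, tQ_one])⟩
    · rintro x y _ ⟨z, rfl⟩ ⟨w, rfl⟩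
      exact ⟨z * w, Subtype.ext (by simp [tH, tQ_mul])⟩

/-- The orbit space `T \ (G \ M̂)`, with the quotient topology. -/
def TQ (m : ℕ) : Type := Quotient (tSetoid m)

instance (m : ℕ) : TopologicalSpace (TQ m) := inferInstanceAs (TopologicalSpace (Quotient _))

/-- The projection `π : G \ M̂ → T \ (G \ M̂)`. -/
def proj {m : ℕ} (q : Qhat m) : TQ m := Quotient.mk (tSetoid m) q

/-- The model space of `T \ (G \ M̂)`. -/
abbrev ModelT (m : ℕ) : Type := (Fin (m - 1) → ℂ) × (Fin 2 → ℝ)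

/-- `(z, w) ↦ (z, log |w₁|, log |w₂|)`. -/
def logG {m : ℕ} (h : ModelG m) : ModelT m := (h.1, fun k => Real.log ‖h.2 k‖)

/-- `(z, s) ↦ (z, exp s₁, exp s₂)`. -/
def expG {m : ℕ} (h : ModelT m) : ModelG m := (h.1, fun k => (Real.exp (h.2 k) : ℂ))

theorem logG_expG {m : ℕ} (h : ModelT m) : logG (expG h) = h := by
  ext k <;> simp [logG, expG, Complex.norm_exp]

theorem contDiff_expG (m : ℕ) : ContDiff ℝ ∞ (expG (m := m)) := by
  refine contDiff_fst.prodMk (contDiff_pi.2 fun k => ?_)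
  exact Complex.ofRealCLM.contDiff.comp (Real.contDiff_exp.comp (by fun_prop))

theorem contDiffOn_logG (m : ℕ) :
    ContDiffOn ℝ ∞ (logG (m := m)) {h | ∀ k, h.2 k ≠ 0} := by
  refine contDiff_fst.contDiffOn.prodMk (contDiffOn_pi.2 fun k => ?_)
  refine ContDiffOn.log (ContDiffOn.norm ℝ (ContDiff.contDiffOn (by fun_prop)) fun h hh => hh k) ?_
  exact fun h hh => norm_ne_zero_iff.2 (hh k)

theorem mem_Qhat_xi {m : ℕ} (x : Mprinc m) :
    xi x ∈ Qhat m ↔ x.1.1 (Sum.inr 0) ≠ 0 ∧ x.1.1 (Sum.inr 1) ≠ 0 := tQ_free_iff x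

theorem chartG_xi {m : ℕ} (i : Fin m) (x : Mprinc m) : chartG i (xi x) = phiG i x.1.1 := rfl

theorem mem_chartG_source {m : ℕ} (i : Fin m) (x : Mprinc m) :
    xi x ∈ (chartG i).source ↔ x.1.1 (Sum.inl i) ≠ 0 := Iff.rfl

theorem chartG_tQ {m : ℕ} (i : Fin m) (z : Tor) (q : QG m) :
    chartG i (tQ z q) = ((chartG i q).1, ![z.1 * (chartG i q).2 0, z.2 * (chartG i q).2 1]) := by
  induction q using Quotient.inductionOn with
  | h x =>
    refine Prod.ext rfl (funext fun k => ?_)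
    fin_cases k
    · exact mul_div_assoc _ _ _
    · exact mul_div_assoc _ _ _

theorem tQ_mem_source {m : ℕ} (i : Fin m) (z : Tor) (q : QG m) :
    tQ z q ∈ (chartG i).source ↔ q ∈ (chartG i).source := by
  induction q using Quotient.inductionOn with
  | h x => exact Iff.rfl

theorem chartG_snd_ne_zero {m : ℕ} (i : Fin m) {q : QG m} (hq : q ∈ Qhat m)
    (hi : q ∈ (chartG i).source) (k : Fin 2) : (chartG i q).2 k ≠ 0 := by
  induction q using Quotient.inductionOn with
  | h x =>
    have h := (mem_Qhat_xi x).1 hq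
    have hi' : x.1.1 (Sum.inl i) ≠ 0 := hi
    change x.1.1 (Sum.inr k) / (‖x.1.1 (Sum.inl i)‖ : ℂ) ≠ 0
    refine div_ne_zero ?_ (by simpa using hi')
    fin_cases k
    · exact h.1
    · exact h.2

theorem chartG_symm_expG_mem {m : ℕ} (i : Fin m) (h : ModelT m) :
    (chartG i).symm (expG h) ∈ Qhat m := by
  refine (mem_Qhat_xi (secG i (expG h))).2 ?_
  simp [secG, preG_inr, expG, preG_ne_zero]

/-- The section `(z, s) ↦ [(u, v)]` with `u_i = c`, `u_j = c z_j`, `v_k = c exp s_k`, `c > 0`. -/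
def secT {m : ℕ} (i : Fin m) (h : ModelT m) : Qhat m :=
  ⟨(chartG i).symm (expG h), chartG_symm_expG_mem i h⟩

theorem chartG_secT {m : ℕ} (i : Fin m) (h : ModelT m) : chartG i (secT i h).1 = expG h :=
  (chartG i).right_inv (mem_univ _)

theorem exists_circle_mul (w : ℂ) (hw : w ≠ 0) : ∃ σ : Circle, (σ : ℂ) * w = ‖w‖ := by
  refine ⟨⟨(‖w‖ : ℂ) / w, by simp [Submonoid.unitSphere, hw]⟩, ?_⟩
  exact div_mul_cancel₀ _ hw

theorem secT_logG {m : ℕ} (i : Fin m) (q : Qhat m) (hq : q.1 ∈ (chartG i).source) :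
    tSetoid m (secT i (logG (chartG i q.1))) q := by
  obtain ⟨σ, hσ⟩ := exists_circle_mul _ (chartG_snd_ne_zero i q.2 hq 0)
  obtain ⟨τ, hτ⟩ := exists_circle_mul _ (chartG_snd_ne_zero i q.2 hq 1)
  refine ⟨(σ, τ), Subtype.ext ?_⟩
  refine (chartG i).injOn ((tQ_mem_source i _ _).2 hq) ((chartG i).map_target (mem_univ _)) ?_
  rw [chartG_secT, chartG_tQ]
  refine Prod.ext rfl (funext fun k => ?_)
  have hk := chartG_snd_ne_zero i q.2 hq k
  fin_cases k
  · simp only [expG, logG, Real.exp_log (norm_pos_iff.2 hk)]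
    exact hσ
  · simp only [expG, logG, Real.exp_log (norm_pos_iff.2 hk)]
    exact hτ

/-- The chart `T [(u, v)] ↦ ((u_j / u_i)_{j ≠ i}, (log (|v_k| / |u_i|))_k)` of `T \ (G \ M̂)`,
defined where `u_i ≠ 0`; it takes all values in the model space. -/
def chartT {m : ℕ} (i : Fin m) : OpenPartialHomeomorph (TQ m) (ModelT m) :=
  quotChart (tSetoid m) (fun q => logG (chartG i q.1)) {q | q.1 ∈ (chartG i).source} (secT i)
    (by
      rintro _ q ⟨z, rfl⟩
      change logG (chartG i (tQ z q.1)) = _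
      rw [chartG_tQ]
      refine Prod.ext rfl (funext fun k => ?_)
      fin_cases k <;> simp [logG, Circle.norm_coe])
    ((chartG i).open_source.preimage continuous_subtype_val)
    (by rintro _ q ⟨z, rfl⟩; exact tQ_mem_source i z q.1)
    ((contDiffOn_logG m).continuousOn.comp
      ((chartG i).continuousOn.comp continuous_subtype_val.continuousOn (fun q hq => hq))
      (fun q hq => chartG_snd_ne_zero i q.2 hq))
    ((continuousOn_univ.1 (chartG i).continuousOn_symm).comp
      (contDiff_expG m).continuous |>.subtype_mk _)
    (fun h => (chartG i).map_target (mem_univ _))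
    (fun h => by rw [chartG_secT, logG_expG])
    (secT_logG i)

theorem exists_chartT (m : ℕ) (b : TQ m) : ∃ i : Fin m, b ∈ (chartT i).source := by
  induction b using Quotient.inductionOn with
  | h q =>
    obtain ⟨q, hq⟩ := q
    induction q using Quotient.inductionOn with
    | h x => exact (gAct_free_iff _).1 x.2

instance chartedSpaceTQ (m : ℕ) : ChartedSpace (ModelT m) (TQ m) where
  atlas := range chartT
  chartAt b := chartT (exists_chartT m b).choose
  mem_chart_source b := (exists_chartT m b).choose_spec
  chart_mem_atlas _ := mem_range_self _

instance isManifoldTQ (m : ℕ) : IsManifold 𝓘(ℝ, ModelT m) ∞ (TQ m) := by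
  apply isManifold_of_contDiffOn
  rintro _ _ ⟨i, rfl⟩ ⟨k, rfl⟩
  have hs : ∀ h : ModelT m, (chartT i).symm h ∈ (chartT k).source →
      (chartG i).symm (expG h) ∈ (chartG k).source := fun h hh => hh
  refine ((contDiffOn_logG m).comp ((contDiffOn_phiG_preG i k).comp
    (contDiff_expG m).contDiffOn ?_) ?_).congr ?_
  · rintro h ⟨⟨-, hh⟩, -⟩
    exact chartG_symm_mem i k _ (hs h hh)
  · rintro h ⟨⟨-, hh⟩, -⟩ l
    change (phiG k (preG i (expG h))).2 l ≠ 0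
    rw [← chartG_symm_apply]
    exact chartG_snd_ne_zero k (chartG_symm_expG_mem i h) (hs h hh) l
  · intro h _
    exact congrArg logG (chartG_symm_apply i k (expG h))

/-! ### The Riemannian metrics

The metrics are given by their norms, as functions on the tangent bundles. The norm of a Riemannian
submersion metric at a tangent vector `X` of the base is the norm of a horizontal lift of `X`, and
this is the least norm of all lifts of `X`. -/

/-- The norm of the round metric `g₀`: the norm in `ℂ^{m+2}`. -/
def normG0 {m : ℕ} (w : TangentBundle (𝓡 (2 * m + 3)) (Mprinc m)) : ℝ :=
  norm (E := Amb m)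
    (mfderiv (𝓡 (2 * m + 3)) 𝓘(ℝ, Amb m) (fun x : Mprinc m => (x.1.1 : Amb m)) w.1 w.2)

/-- The norm of the metric `h₀` on `G \ M_princ` which turns `ξ : (M_princ, g₀) → G \ M_princ` into
a Riemannian submersion. -/
def normH0 {m : ℕ} (X : TangentBundle 𝓘(ℝ, ModelG m) (QG m)) : ℝ :=
  sInf {r | ∃ w : TangentBundle (𝓡 (2 * m + 3)) (Mprinc m),
    tangentMap (𝓡 (2 * m + 3)) 𝓘(ℝ, ModelG m) xi w = X ∧ normG0 w = r}

/-- The norm of `h₀` on the open subset `G \ M̂`. -/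
def normH0hat {m : ℕ} (X : TangentBundle 𝓘(ℝ, ModelG m) (Qhat m)) : ℝ :=
  normH0 (tangentMap 𝓘(ℝ, ModelG m) 𝓘(ℝ, ModelG m) (Subtype.val : Qhat m → QG m) X)

/-- The norm of the metric `h₀^T` on `T \ (G \ M̂)` which turns
`π : (G \ M̂, h₀) → T \ (G \ M̂)` into a Riemannian submersion. -/
def normH0T {m : ℕ} (Y : TangentBundle 𝓘(ℝ, ModelT m) (TQ m)) : ℝ :=
  sInf {r | ∃ X : TangentBundle 𝓘(ℝ, ModelG m) (Qhat m),
    tangentMap 𝓘(ℝ, ModelG m) 𝓘(ℝ, ModelT m) proj X = Y ∧ normH0hat X = r}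

/-! ### The Lie algebra of the torus -/

/-- The model with corners of `T`. -/
abbrev ITor : ModelWithCorners ℝ (EuclideanSpace ℝ (Fin 1) × EuclideanSpace ℝ (Fin 1))
    (ModelProd (EuclideanSpace ℝ (Fin 1)) (EuclideanSpace ℝ (Fin 1))) := (𝓡 1).prod (𝓡 1)

/-- `𝔱 = T_e T`. -/
abbrev LieT : Type := TangentSpace ITor (1 : Tor)

/-- The curves `t ↦ (e^{it}, 1)` and `t ↦ (1, e^{it})` in `T`. -/
def curveT (k : Fin 2) (t : ℝ) : Tor := ![(Circle.exp t, 1), (1, Circle.exp t)] k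

/-- The basis vectors `Z₁ = (i, 0)` and `Z₂ = (0, i)` of `𝔱`, for `k = 0, 1`: the velocities at
`t = 0` of the curves `(e^{it}, 1)` and `(1, e^{it})`, which start at `1`. -/
def basisZ (k : Fin 2) : LieT := mfderiv 𝓘(ℝ, ℝ) ITor (curveT k) 0 (1 : ℝ)

/-- The value at `q` of the fundamental vector field `Z^*` on `G \ M_princ`, i.e. the image of `Z`
under the differential at `1` of `z ↦ z q`. -/
def fundQ {m : ℕ} (Z : LieT) (q : QG m) : TangentBundle 𝓘(ℝ, ModelG m) (QG m) :=
  tangentMap ITor 𝓘(ℝ, ModelG m) (fun z : Tor => tQ z q) ⟨1, Z⟩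

/-! ### The group `Aut^T_{h₀}(G \ M_princ)` and the sets `𝒟` and `ℰ` -/

/-- Diffeomorphisms of `G \ M_princ`. -/
abbrev DiffeoQ (m : ℕ) : Type :=
  Diffeomorph 𝓘(ℝ, ModelG m) 𝓘(ℝ, ModelG m) (QG m) (QG m) ∞

/-- Diffeomorphisms of `T \ (G \ M̂)`. -/
abbrev DiffeoTQ (m : ℕ) : Type :=
  Diffeomorph 𝓘(ℝ, ModelT m) 𝓘(ℝ, ModelT m) (TQ m) (TQ m) ∞

/-- `F` is `T`-preserving: `F ∘ z ∘ F⁻¹ ∈ T` for all `z ∈ T`. -/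
def TPreserving {m : ℕ} (F : DiffeoQ m) : Prop :=
  ∀ z : Tor, ∃ w : Tor, ∀ q, F (tQ z (F.symm q)) = tQ w q

/-- `c^F : T → T`, `c^F(z) = F ∘ z ∘ F⁻¹`. As `T` acts effectively, this determines `c^F(z)`. -/
def conjT {m : ℕ} (F : DiffeoQ m) (hF : TPreserving F) (z : Tor) : Tor := (hF z).choose

/-- `Ψ_F = c^F_* : 𝔱 → 𝔱`, the differential of `c^F` at `1` (note that `c^F(1) = 1`). -/
def PsiF {m : ℕ} (F : DiffeoQ m) (hF : TPreserving F) : LieT →L[ℝ] LieT :=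
  mfderiv ITor ITor (conjT F hF) 1

/-- `F` induces an isometry of the Riemannian manifold `(T \ (G \ M̂), h₀^T)`. -/
def InducesIsometry {m : ℕ} (F : DiffeoQ m) : Prop :=
  ∃ Fbar : DiffeoTQ m,
    (∀ q : Qhat m, ∃ q' : Qhat m, q'.1 = F q.1 ∧ Fbar (proj q) = proj q') ∧
    ∀ Y, normH0T (tangentMap 𝓘(ℝ, ModelT m) 𝓘(ℝ, ModelT m) Fbar Y) = normH0T Y

/-- `Aut^T_{h₀}(G \ M_princ)`: the `T`-preserving diffeomorphisms which preserve the `h₀`-norm of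
vectors tangent to the `T`-orbits in `G \ M̂` and induce an isometry of `(T \ (G \ M̂), h₀^T)`. -/
structure IsAutT {m : ℕ} (F : DiffeoQ m) : Prop where
  tPreserving : TPreserving F
  norm_vertical : ∀ q ∈ Qhat m, ∀ Z : LieT,
    normH0 (tangentMap 𝓘(ℝ, ModelG m) 𝓘(ℝ, ModelG m) F (fundQ Z q)) = normH0 (fundQ Z q)
  inducesIsometry : InducesIsometry F

/-- `𝒟 = {Ψ_F ; F ∈ Aut^T_{h₀}(G \ M_princ)}`. -/
def calD (m : ℕ) : Set (LieT →L[ℝ] LieT) :=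
  {ψ | ∃ (F : DiffeoQ m) (hF : IsAutT F), ψ = PsiF F hF.tPreserving}

/-- `ℰ`, the automorphisms `φ` of `𝔱` with `φ(Z_k) ∈ {± Z₁, ± Z₂}` for `k = 1, 2`. -/
def calE : Set (LieT →L[ℝ] LieT) :=
  {φ | Function.Bijective φ ∧
    ∀ k, φ (basisZ k) ∈ ({basisZ 0, -basisZ 0, basisZ 1, -basisZ 1} : Set LieT)}

end SphereQuotient
end

namespace SphereQuotient

/-! ### Continuous injective endomorphisms of the circle -/

/-! Since `F (z q) = c^F(z) F(q)`, the stabilizer of `q` is the preimage under `c^F` of the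
stabilizer of `F q`. The stabilizer of `[(u, v)]` is cut out by `z_k = 1` for those `k` with `v_k ≠
0`, so it is trivial, one of the two coordinate circles, or `T` (`tQ_xi_eq_iff`), and both circles
occur. As `c^F` has trivial kernel, the circle `{z_k = 1}` can only correspond to a circle `{z_l =
1}` (`exists_torPr_conjT_eq_one_iff`).

Hence the `l`-th component of `c^F(z)` depends only on `z_k`, through a continuous injective
endomorphism of the circle, which is the identity or the inversion (`circle_hom_eq_id_or_inv`). So
`c^F` permutes the two factors of `T` up to inversions (`exists_conjT_eq_signedPerm`), and its
differential permutes `Z₁`, `Z₂` up to signs (`mfderiv_mem_calE`). -/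

theorem circleExp_two_pi_mul_eq_one {a : ℝ} (h : Circle.exp (2 * Real.pi * a) = 1) :
    ∃ n : ℤ, a = n := by
  obtain ⟨n, hn⟩ := Circle.exp_eq_one.1 h
  refine ⟨n, ?_⟩
  have : (2 * Real.pi) * a = (2 * Real.pi) * n := by rw [hn]; ring
  exact mul_left_cancel₀ (by positivity) this

/-- A continuous one-parameter subgroup of the circle is `t ↦ e^{iat}`. -/
theorem exists_eq_circleExp_mul (f : ℝ → Circle) (hf : Continuous f)
    (hadd : ∀ s t, f (s + t) = f s * f t) : ∃ a : ℝ, ∀ t, f t = Circle.exp (t * a) := by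
  have h0 : f 0 = 1 := by simpa using hadd 0 0
  -- Lift `f` through the covering `Circle.exp` to a real function `g` with `g 0 = 0`.
  obtain ⟨g, ⟨hg0, hg⟩, -⟩ := Circle.isCoveringMap_exp.existsUnique_continuousMap_lifts
    ⟨f, hf⟩ 0 0 (by simp [h0])
  have hg' : ∀ t, Circle.exp (g t) = f t := fun t => congrFun hg t
  have hgadd : ∀ s t, g (s + t) = g s + g t := by
    -- Both sides lift the same map on the connected space `ℝ × ℝ` and agree at the origin.
    -- Additivity and continuity then make `g` linear.
    have := Circle.isCoveringMap_exp.eq_of_comp_eq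
      (g₁ := fun p : ℝ × ℝ => g (p.1 + p.2)) (g₂ := fun p : ℝ × ℝ => g p.1 + g p.2)
      (by fun_prop) (by fun_prop)
      (by funext p; simp [hg', hadd, Circle.exp_add]) (0, 0) (by simp [hg0])
    exact fun s t => congrFun this (s, t)
  refine ⟨g 1, fun t => ?_⟩
  have := map_real_smul (AddMonoidHom.mk' g hgadd) g.continuous t 1
  simp only [smul_eq_mul, mul_one, AddMonoidHom.mk'_apply] at this
  rw [← hg', this]

/-- Such a `χ` is `z ↦ z ^ n`, whose kernel is trivial only for `n = ±1`. -/
theorem circle_hom_eq_id_or_inv (χ : Circle →* Circle) (hc : Continuous χ)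
    (hinj : Function.Injective χ) : (∀ z, χ z = z) ∨ ∀ z, χ z = z⁻¹ := by
  obtain ⟨a, ha⟩ := exists_eq_circleExp_mul (fun t => χ (Circle.exp t))
    (hc.comp (map_continuous Circle.exp)) (fun s t => by rw [Circle.exp_add, map_mul])
  obtain ⟨n, rfl⟩ : ∃ n : ℤ, a = n := circleExp_two_pi_mul_eq_one (by
    rw [← ha, Circle.exp_two_pi, map_one])
  have hn : n ≠ 0 := by
    rintro rfl
    refine Circle.exp_pi_ne_one (hinj ?_)
    simp [ha]
  have hn' : (n : ℝ) ≠ 0 := by exact_mod_cast hn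
  -- The root of unity `e^{2πi/n}` lies in the kernel, so injectivity makes `1 / n` an integer.
  obtain ⟨k, hk⟩ : ∃ k : ℤ, (n : ℝ)⁻¹ = k := circleExp_two_pi_mul_eq_one (hinj (by
    rw [ha, mul_assoc, inv_mul_cancel₀ hn', mul_one, Circle.exp_two_pi, map_one]))
  have hkn : n * k = 1 := by
    have : (n : ℝ) * k = 1 := by rw [← hk, mul_inv_cancel₀ hn']
    exact_mod_cast this
  have hexp : ∀ z : Circle, ∃ t, Circle.exp t = z := fun z => ⟨_, Circle.exp_arg z⟩
  rcases Int.eq_one_or_neg_one_of_mul_eq_one hkn with rfl | rfl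
  · refine Or.inl fun z => ?_
    obtain ⟨t, rfl⟩ := hexp z
    simp [ha]
  · refine Or.inr fun z => ?_
    obtain ⟨t, rfl⟩ := hexp z
    simp [ha, Circle.exp_neg]

/-! ### The stabilizers of the `T`-action -/

/-- The `k`-th component of an element of `T`. -/
noncomputable def torPr (k : Fin 2) : Tor →* Circle :=
  ![MonoidHom.fst Circle Circle, MonoidHom.snd Circle Circle] k

/-- The inclusion of the `k`-th circle in `T`. -/
noncomputable def torIncl (k : Fin 2) : Circle →* Tor :=
  ![MonoidHom.inl Circle Circle, MonoidHom.inr Circle Circle] k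

theorem continuous_torPr (k : Fin 2) : Continuous (torPr k) := by
  fin_cases k
  · exact continuous_fst
  · exact continuous_snd

theorem continuous_torIncl (k : Fin 2) : Continuous (torIncl k) := by
  fin_cases k
  · exact Continuous.prodMk_left 1
  · exact Continuous.prodMk_right 1

theorem torPr_torIncl (k : Fin 2) (σ : Circle) : torPr k (torIncl k σ) = σ := by
  fin_cases k <;> rfl

theorem torPr_torIncl_of_ne {k l : Fin 2} (h : k ≠ l) (σ : Circle) :
    torPr k (torIncl l σ) = 1 := by
  fin_cases k <;> fin_cases l <;> first | exact absurd rfl h | rfl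

theorem tAmb_inr {m : ℕ} (z : Tor) (x : Amb m) (k : Fin 2) :
    tAmb z x (Sum.inr k) = torPr k z * x (Sum.inr k) := by
  fin_cases k <;> rfl

/-- The element of `G` hidden in an equality of orbits does not move the `v`-coordinates, so a
nonzero `v_k` can be cancelled. Thus every stabilizer is an intersection of kernels of the `torPr
k`. -/
theorem tQ_xi_eq_iff {m : ℕ} (z : Tor) (x : Mprinc m) :
    tQ z (xi x) = xi x ↔ ∀ k, x.1.1 (Sum.inr k) ≠ 0 → torPr k z = 1 := by
  constructor
  · intro hz k hk
    obtain ⟨σ, hσ⟩ := Quotient.exact hz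
    have e := congrArg (fun y : Mprinc m => y.1.1 (Sum.inr k)) hσ
    simp only [gP, gAct, tP, tAct, gAmb_inr, tAmb_inr] at e
    exact Circle.ext (mul_right_cancel₀ hk ((one_mul _).trans e)).symm
  · intro h
    have hk : ∀ k, (torPr k z : ℂ) * x.1.1 (Sum.inr k) = x.1.1 (Sum.inr k) := fun k => by
      by_cases h0 : x.1.1 (Sum.inr k) = 0
      · simp [h0]
      · simp [h k h0]
    exact congrArg xi (Subtype.ext (Subtype.ext (amb_ext (fun _ => rfl) (hk 0) (hk 1))))

theorem exists_stabilizer_eq_ker_torPr {m : ℕ} (i : Fin m) (k : Fin 2) :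
    ∃ q : QG m, ∀ z, tQ z q = q ↔ torPr k z = 1 := by
  -- Up to rescaling, this point has `u_i = v_k = 1` and all other coordinates zero.
  refine ⟨xi (secG i (0, Pi.single k 1)), fun z => ?_⟩
  rw [tQ_xi_eq_iff]
  have hs : ∀ l, (secG i ((0, Pi.single k 1) : ModelG m)).1.1 (Sum.inr l) ≠ 0 ↔ l = k := by
    intro l
    change ‖preG i _‖⁻¹ • preG i _ (Sum.inr l) ≠ 0 ↔ _
    rw [smul_ne_zero_iff_right (norm_preG_pos i _).ne', preG_inr]
    by_cases h : l = k <;> simp [h]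
  simp only [hs, forall_eq]

/-- The index `i` records that `m` is positive; for `m = 0` the space is empty. The witness has `u_i
= v₁ = v₂` positive. -/
theorem exists_mem_Qhat {m : ℕ} (i : Fin m) : ∃ q, q ∈ Qhat m :=
  ⟨_, chartG_symm_expG_mem i 0⟩

theorem continuous_tQ {m : ℕ} (q : QG m) : Continuous fun z => tQ z q := by
  induction q using Quotient.inductionOn with
  | h x =>
    refine continuous_quot_mk.comp (Continuous.subtype_mk (Continuous.subtype_mk
      ((PiLp.continuous_toLp 2 _).comp (continuous_pi fun l => ?_)) _) _)
    rcases l with j | k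
    · exact continuous_const
    · fin_cases k
      · exact (continuous_induced_dom.comp continuous_fst).mul continuous_const
      · exact (continuous_induced_dom.comp continuous_snd).mul continuous_const

/-! ### The automorphism of `T` given by conjugation -/

/-- Freeness on `Qhat` allows identities between values of `conjT`, which are obtained by choice, to
be checked at a single point. -/
theorem tor_eq_of_tQ_eq {m : ℕ} {q : QG m} (hq : q ∈ Qhat m) {z w : Tor}
    (h : tQ z q = tQ w q) : z = w := by
  refine (inv_mul_eq_one.1 (hq (w⁻¹ * z) ?_)).symm
  rw [tQ_mul, h, ← tQ_mul, inv_mul_cancel, tQ_one]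

theorem apply_tQ {m : ℕ} {F : DiffeoQ m} (hF : TPreserving F) (z : Tor) (q : QG m) :
    F (tQ z q) = tQ (conjT F hF z) (F q) := by
  have h : F (tQ z (F.symm (F q))) = tQ (conjT F hF z) (F q) := (hF z).choose_spec (F q)
  rwa [Diffeomorph.symm_apply_apply] at h

theorem tQ_conjT_eq_iff {m : ℕ} {F : DiffeoQ m} (hF : TPreserving F) (z : Tor) (q : QG m) :
    tQ (conjT F hF z) (F q) = F q ↔ tQ z q = q := by
  rw [← apply_tQ]
  exact F.injective.eq_iff

/-- `c^F` as a group homomorphism. -/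
noncomputable def conjHom {m : ℕ} (i : Fin m) (F : DiffeoQ m) (hF : TPreserving F) :
    Tor →* Tor :=
  MonoidHom.mk' (conjT F hF) fun z w => by
    obtain ⟨p, hp⟩ := exists_mem_Qhat i
    obtain ⟨q, rfl⟩ := F.surjective p
    refine tor_eq_of_tQ_eq hp ?_
    change tQ (conjT F hF (z * w)) (F q) = tQ (conjT F hF z * conjT F hF w) (F q)
    rw [← apply_tQ, tQ_mul, tQ_mul, apply_tQ, apply_tQ]

/-- In a chart around `p` in `Qhat`, `T` acts by multiplying the `v`-coordinates. So each component
of `c^F(z)` is a coordinate of `F (z F⁻¹(p))` divided by the corresponding nonzero coordinate of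
`p`. -/
theorem continuous_conjT {m : ℕ} (i : Fin m) {F : DiffeoQ m} (hF : TPreserving F) :
    Continuous (conjT F hF) := by
  have hs : (chartG i).symm (expG 0) ∈ (chartG i).source := (chartG i).map_target (mem_univ _)
  have hp := chartG_symm_expG_mem i 0
  generalize (chartG i).symm (expG 0) = p at hs hp
  have hz : ∀ z, F (tQ z (F.symm p)) = tQ (conjT F hF z) p := fun z => by
    rw [apply_tQ, Diffeomorph.apply_symm_apply]
  have hc : Continuous fun z => chartG i (F (tQ z (F.symm p))) := by
    refine continuousOn_univ.1 ((chartG i).continuousOn.comp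
      (F.continuous.comp (continuous_tQ _)).continuousOn fun z _ => ?_)
    rw [hz, tQ_mem_source]
    exact hs
  have hk : ∀ k, Continuous fun z => torPr k (conjT F hF z) := fun k => by
    refine continuous_induced_rng.2 ((((continuous_apply k).comp (continuous_snd.comp hc)).div_const
      ((chartG i p).2 k)).congr fun z => ?_)
    have h0 := chartG_snd_ne_zero i hp hs k
    simp only [Function.comp_apply, hz, chartG_tQ]
    fin_cases k
    · exact mul_div_cancel_right₀ _ h0
    · exact mul_div_cancel_right₀ _ h0
  exact (hk 0).prodMk (hk 1)

/-- `F` maps the points with stabilizer `{z ; z_k = 1}` to such points, for some other index. -/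
theorem exists_torPr_conjT_eq_one_iff {m : ℕ} (i : Fin m) {F : DiffeoQ m} (hF : TPreserving F)
    (k : Fin 2) : ∃ l, ∀ z, torPr l (conjT F hF z) = 1 ↔ torPr k z = 1 := by
  obtain ⟨q, hq⟩ := exists_stabilizer_eq_ker_torPr i k
  have hst : ∀ z, tQ (conjT F hF z) (F q) = F q ↔ torPr k z = 1 := fun z => by
    rw [tQ_conjT_eq_iff, hq]
  have hinj : ∀ z, conjT F hF z = 1 → z = 1 := fun z hz => by
    obtain ⟨p, hp⟩ := exists_mem_Qhat i
    exact hp z ((tQ_conjT_eq_iff hF z p).1 (by rw [hz, tQ_one]))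
  obtain ⟨x, hx⟩ : ∃ x, xi x = F q := Quotient.exists_rep _
  simp only [← hx, tQ_xi_eq_iff, Fin.forall_fin_two] at hst
  obtain ⟨l, hl⟩ : ∃ l, l ≠ k := exists_ne k
  have hpi := Circle.exp_pi_ne_one
  -- The four cases are the possible stabilizers of `F q`. If it were `T`, then `torPr k` would be
  -- trivial. If it were trivial, `c^F` would kill the circle `{z_k = 1}`, against `hinj`; the
  -- element `-1` of that circle suffices.
  by_cases h0 : x.1.1 (Sum.inr 0) = 0 <;> by_cases h1 : x.1.1 (Sum.inr 1) = 0 <;>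
    simp only [h0, h1, ne_eq, not_true_eq_false, not_false_eq_true, false_imp_iff, true_imp_iff,
      true_and, and_true] at hst
  · exact absurd ((hst (torIncl k (Circle.exp Real.pi))).1 trivial) (by rwa [torPr_torIncl])
  · exact ⟨1, hst⟩
  · exact ⟨0, hst⟩
  · have h := (hst (torIncl l (Circle.exp Real.pi))).2 (torPr_torIncl_of_ne hl.symm _)
    have h' := congrArg (torPr l) (hinj _ (Prod.ext h.1 h.2))
    rw [torPr_torIncl, map_one] at h'
    exact absurd h' hpi

/-- Up to a permutation of the factors of `T`, the map `c^F` is the identity or the inversion on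
each factor. -/
theorem torPr_conjT {m : ℕ} (i : Fin m) {F : DiffeoQ m} (hF : TPreserving F) (k : Fin 2) :
    ∃ l, (∀ z, torPr l (conjT F hF z) = 1 ↔ torPr k z = 1) ∧
      ((∀ z, torPr l (conjT F hF z) = torPr k z) ∨
        ∀ z, torPr l (conjT F hF z) = (torPr k z)⁻¹) := by
  obtain ⟨l, hl⟩ := exists_torPr_conjT_eq_one_iff i hF k
  refine ⟨l, hl, ?_⟩
  let c := conjHom i F hF
  let χ : Circle →* Circle := ((torPr l).comp c).comp (torIncl k)
  have hχ : ∀ z, torPr l (conjT F hF z) = χ (torPr k z) := fun z => by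
    -- Removing the `k`-th component of `z` leaves an element of the kernel of `torPr k`, which
    -- `torPr l ∘ c` sends to `1`.
    have h : torPr l (c (z * (torIncl k (torPr k z))⁻¹)) = 1 := (hl _).2 (by
      rw [map_mul, map_inv, torPr_torIncl, mul_inv_cancel])
    rw [map_mul, map_mul, map_inv, map_inv] at h
    exact mul_inv_eq_one.1 h
  have hinj : Function.Injective χ := (injective_iff_map_eq_one χ).2 fun σ hσ => by
    rw [← torPr_torIncl k σ]
    exact (hl _).1 hσ
  have hc : Continuous χ :=
    (continuous_torPr l).comp ((continuous_conjT i hF).comp (continuous_torIncl k))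
  simp only [hχ]
  exact (circle_hom_eq_id_or_inv χ hc hinj).imp (fun h z => h _) fun h z => h _

/-- The identity (for `b = false`) or the inversion (for `b = true`) of the circle. -/
noncomputable def flipCircle (b : Bool) (z : Circle) : Circle := if b then z⁻¹ else z

/-- The automorphisms of `T` given by permutations of the factors and inversions of factors. -/
noncomputable def signedPerm (s b b' : Bool) (z : Tor) : Tor :=
  (flipCircle b (if s then z.2 else z.1), flipCircle b' (if s then z.1 else z.2))

theorem exists_conjT_eq_signedPerm {m : ℕ} (i : Fin m) {F : DiffeoQ m} (hF : TPreserving F) :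
    ∃ s b b', conjT F hF = signedPerm s b b' := by
  obtain ⟨l, hl, h⟩ := torPr_conjT i hF 0
  obtain ⟨l', hl', h'⟩ := torPr_conjT i hF 1
  -- If `l = l'`, the kernels of `torPr 0` and `torPr 1` would coincide; `(1, -1)` separates them.
  have hne : l ≠ l' := by
    rintro rfl
    have := (hl (torIncl 1 (Circle.exp Real.pi))).2 (torPr_torIncl_of_ne (by decide) _)
    rw [hl', torPr_torIncl] at this
    exact Circle.exp_pi_ne_one this
  obtain ⟨b, hb⟩ : ∃ b, ∀ z, torPr l (conjT F hF z) = flipCircle b z.1 :=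
    h.elim (fun h => ⟨false, h⟩) fun h => ⟨true, h⟩
  obtain ⟨b', hb'⟩ : ∃ b, ∀ z, torPr l' (conjT F hF z) = flipCircle b z.2 :=
    h'.elim (fun h => ⟨false, h⟩) fun h => ⟨true, h⟩
  fin_cases l <;> fin_cases l' <;> first | exact absurd rfl hne | skip
  · exact ⟨false, b, b', funext fun z => Prod.ext (hb z) (hb' z)⟩
  -- The flips in `signedPerm` belong to the output components, hence they are exchanged here.
  · exact ⟨true, b', b, funext fun z => Prod.ext (hb' z) (hb z)⟩

/-! ### The differential -/

/-- This is where differentiability of `c^F` comes from: before its explicit form is known, it is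
only continuous, and `mfderiv` is zero by default at points of non-differentiability. -/
theorem contMDiff_signedPerm (s b b' : Bool) : ContMDiff ITor ITor ∞ (signedPerm s b b') := by
  have h1 : ContMDiff ITor (𝓡 1) ∞ (Prod.fst : Tor → Circle) := contMDiff_fst
  have h2 : ContMDiff ITor (𝓡 1) ∞ (Prod.snd : Tor → Circle) := contMDiff_snd
  cases s <;> cases b <;> cases b' <;>
    first
    | exact h1.prodMk h2 | exact h1.prodMk h2.inv | exact h1.inv.prodMk h2
    | exact h1.inv.prodMk h2.inv | exact h2.prodMk h1 | exact h2.prodMk h1.inv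
    | exact h2.inv.prodMk h1 | exact h2.inv.prodMk h1.inv

/-- These maps form a dihedral group of order eight, so all orders divide four; a swap with exactly
one inversion has order four. This gives bijectivity of the differential without writing down
inverses. -/
theorem signedPerm_iterate_four (s b b' : Bool) : (signedPerm s b b')^[4] = id := by
  funext z
  cases s <;> cases b <;> cases b' <;> simp [signedPerm, flipCircle]

theorem signedPerm_one (s b b' : Bool) : signedPerm s b b' 1 = 1 := by
  cases s <;> cases b <;> cases b' <;> simp [signedPerm, flipCircle]

/-- Inversion on the circle reverses time along `e^{it}`; the sign `ε` becomes the sign in front of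
the basis vector after differentiation. -/
theorem signedPerm_curveT (s b b' : Bool) (k : Fin 2) : ∃ (l : Fin 2) (ε : ℝ),
    (ε = 1 ∨ ε = -1) ∧ ∀ t, signedPerm s b b' (curveT k t) = curveT l (ε * t) := by
  have key : ∀ b, ∃ ε : ℝ, (ε = 1 ∨ ε = -1) ∧
      ∀ t, flipCircle b (Circle.exp t) = Circle.exp (ε * t) := by
    intro b
    cases b
    · exact ⟨1, Or.inl rfl, fun t => by simp [flipCircle]⟩
    · exact ⟨-1, Or.inr rfl, fun t => by simp [flipCircle]⟩
  have h1 : ∀ b, flipCircle b 1 = 1 := fun b => by cases b <;> simp [flipCircle]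
  obtain ⟨ε, hε, h⟩ := key b
  obtain ⟨ε', hε', h'⟩ := key b'
  cases s <;> fin_cases k
  · exact ⟨0, ε, hε, fun t => Prod.ext (h t) (h1 b')⟩
  · exact ⟨1, ε', hε', fun t => Prod.ext (h1 b) (h' t)⟩
  · exact ⟨1, ε', hε', fun t => Prod.ext (h1 b) (h' t)⟩
  · exact ⟨0, ε, hε, fun t => Prod.ext (h t) (h1 b')⟩

theorem contMDiff_curveT (k : Fin 2) : ContMDiff 𝓘(ℝ, ℝ) ITor ∞ (curveT k) := by
  fin_cases k
  · exact contMDiff_circleExp.prodMk contMDiff_const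
  · exact contMDiff_const.prodMk contMDiff_circleExp

theorem curveT_zero (k : Fin 2) : curveT k 0 = 1 := by
  fin_cases k <;> simp [curveT]

theorem mfderiv_curveT_mul (k : Fin 2) (ε : ℝ) :
    (mfderiv 𝓘(ℝ, ℝ) ITor (fun t : ℝ => curveT k (ε * t)) 0 (1 : ℝ) : LieT) = ε • basisZ k := by
  have hk : MDifferentiableAt 𝓘(ℝ, ℝ) ITor (curveT k) 0 :=
    (contMDiff_curveT k).mdifferentiable (by simp) _
  have hd : HasFDerivAt (fun t : ℝ => ε * t) (ε • ContinuousLinearMap.id ℝ ℝ) 0 :=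
    (hasFDerivAt_id (0 : ℝ)).const_mul ε
  have h := mfderiv_comp_apply_of_eq (x := (0 : ℝ)) hk
    hd.differentiableAt.mdifferentiableAt (mul_zero ε) (1 : ℝ)
  refine h.trans ?_
  rw [mfderiv_eq_fderiv, hd.fderiv]
  exact map_smul (mfderiv 𝓘(ℝ, ℝ) ITor (curveT k) 0) ε (1 : ℝ)

/-- By the chain rule at the fixed point `1`, the fourth iterate of the differential is the
identity, so the differential is bijective. Its values on the basis are the velocities of the image
curves. -/
theorem mfderiv_mem_calE {c : Tor → Tor} (hc : ContMDiff ITor ITor ∞ c) (h1 : c 1 = 1)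
    (h4 : c^[4] = id) (hk : ∀ k, ∃ (l : Fin 2) (ε : ℝ), (ε = 1 ∨ ε = -1) ∧
      ∀ t, c (curveT k t) = curveT l (ε * t)) :
    (mfderiv ITor ITor c 1 : LieT →L[ℝ] LieT) ∈ calE := by
  have hd : MDifferentiable ITor ITor c := hc.mdifferentiable (by simp)
  constructor
  · have h : ∀ v : LieT, (mfderiv ITor ITor c 1 : LieT →L[ℝ] LieT)^[4] v = v := fun v => by
      have e4 : mfderiv ITor ITor (c ∘ c ∘ c ∘ c) 1 v = v := by
        have : c ∘ c ∘ c ∘ c = id := h4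
        rw [this, mfderiv_id]
        rfl
      have e3 := mfderiv_comp_apply_of_eq (x := (1 : Tor)) (hd 1) ((hd.comp (hd.comp hd)) 1)
        (by simp [h1]) v
      have e2 := mfderiv_comp_apply_of_eq (x := (1 : Tor)) (hd 1) ((hd.comp hd) 1)
        (by simp [h1]) v
      have e1 := mfderiv_comp_apply_of_eq (x := (1 : Tor)) (hd 1) (hd 1) h1 v
      refine Eq.trans ?_ e4
      refine Eq.trans ?_ e3.symm
      refine congrArg (mfderiv ITor ITor c 1 : LieT →L[ℝ] LieT) (Eq.trans ?_ e2.symm)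
      exact congrArg (mfderiv ITor ITor c 1 : LieT →L[ℝ] LieT) e1.symm
    have hb : Function.Bijective (mfderiv ITor ITor c 1 : LieT →L[ℝ] LieT)^[4] := by
      rw [funext h]
      exact Function.bijective_id
    -- With `D` the differential, injectivity of `D³ ∘ D` gives that of `D`, and `v = D (D³ v)`
    -- gives surjectivity.
    exact ⟨hb.1.of_comp (f := (mfderiv ITor ITor c 1 : LieT →L[ℝ] LieT)^[3]),
      fun v => ⟨_, (Function.iterate_succ_apply' _ 3 v).symm.trans (h v)⟩⟩
  · intro k
    obtain ⟨l, ε, hε, h⟩ := hk k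
    have e := mfderiv_comp_apply_of_eq (x := (0 : ℝ)) (hd 1)
      ((contMDiff_curveT k).mdifferentiable (by simp) 0) (curveT_zero k) (1 : ℝ)
    have e' : (mfderiv ITor ITor c 1 : LieT →L[ℝ] LieT) (basisZ k) = ε • basisZ l := by
      refine Eq.trans e.symm ?_
      rw [← mfderiv_curveT_mul, show c ∘ curveT k = fun t => curveT l (ε * t) from funext h]
    have hm : ε • basisZ l ∈ ({basisZ 0, -basisZ 0, basisZ 1, -basisZ 1} : Set LieT) := by
      rcases hε with rfl | rfl <;> fin_cases l <;> simp
    exact mem_of_eq_of_mem e' hm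

end SphereQuotient

/-- The stabilizers of the points of `G \ M_princ` with exactly one vanishing `v_k` are the two
coordinate circles of `T`, so `c^F` permutes these circles; this uses only that `F` is a
`T`-preserving diffeomorphism of all of `G \ M_princ`. -/
theorem lemma6p3 (m : ℕ) (hm : 3 ≤ m) : SphereQuotient.calD m ⊆ SphereQuotient.calE := by
  open SphereQuotient in
  rintro _ ⟨F, hF, rfl⟩
  obtain ⟨s, b, b', h⟩ := exists_conjT_eq_signedPerm ⟨0, by omega⟩ hF.tPreserving
  rw [PsiF, h]
  exact mfderiv_mem_calE (contMDiff_signedPerm s b b') (signedPerm_one s b b')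
    (signedPerm_iterate_four s b b') (signedPerm_curveT s b b')
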